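/- In a category $\mathbb{C}$, call a span $A_1 \xleftarrow{a_1} A \xrightarrow{a_2} A_2$ a product diagram if it exhibits $A$ as a categorical product of $A_1$ and $A_2$; a morphism $p\colon A \to A_1$ is a product projection of $A$ if it is a leg of some such product diagram. A morphism $f\colon A \to X$ of $\mathbb{C}$ is called coextensive if the following two conditions hold. (C1) $f$ admits pushouts along the projections of any product diagram $A_1 \xleftarrow{a_1} A \xrightarrow{a_2} A_2$, and the pushouts $X \xrightarrow{x_1} X_1$ of $a_1$ along $f$ and $X \xrightarrow{x_2} X_2$ of $a_2$ along $f$ form a product diagram $X_1 \xleftarrow{x_1} X \xrightarrow{x_2} X_2$. (C2) For any product diagrams $A_1 \xleftarrow{a_1} A \xrightarrow{a_2} A_2$ and $X_1 \xleftarrow{x_1} X \xrightarrow{x_2} X_2$ and any morphisms $f_i\colon A_i \to X_i$ with $f_i a_i = x_i f$ ($i=1,2$), both of these commutative squares are pushouts. A monoid $M$ is centerless if its center $\mathsf{Z}(M) = \{x \in M \mid xy = yx \text{ for all } y \in M\}$ consists of the neutral element only. **Proposition.** Let $M$ be a centerless monoid. Then every product projection $p\colon M \to A$ of $M$ is coextensive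 in the category $\mathsf{Mon}$ of monoids and monoid homomorphisms. -/

import Mathlib

open CategoryTheory CategoryTheory.Limits

universe v u

section Coextensive

variable {C : Type u} [Category.{v} C]

/-- The span `X₁ ⟵ X ⟶ X₂` is a (binary) product diagram: it exhibits `X` as a categorical
product of `X₁` and `X₂`, with the two given morphisms as projections. -/
def IsProductDiagram {X X₁ X₂ : C} (p₁ : X ⟶ X₁) (p₂ : X ⟶ X₂) : Prop :=
  Nonempty (IsLimit (BinaryFan.mk p₁ p₂))

/-- `p : X ⟶ A` is a product projection (of `X`): it is one of the two legs of some binary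
product diagram `A ⟵ X ⟶ B`. -/
def IsProductProjection {X A : C} (p : X ⟶ A) : Prop :=
  ∃ (B : C) (q : X ⟶ B), IsProductDiagram p q

/-- A morphism `f : A ⟶ X` is coextensive if it satisfies the two conditions below; they are dual to
the two conditions for extensive morphisms (pullbacks along coproduct injections). -/
structure IsCoextensive {A X : C} (f : A ⟶ X) : Prop where
  /-- `f` admits pushouts along the projections of any product diagram `A₁ ⟵ A ⟶ A₂`. -/
  hasPushouts : ∀ {A₁ A₂ : C} (a₁ : A ⟶ A₁) (a₂ : A ⟶ A₂), IsProductDiagram a₁ a₂ →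
    HasPushout a₁ f ∧ HasPushout a₂ f
  /-- Pushing out `f` along the two projections of a product diagram `A₁ ⟵ A ⟶ A₂` results in a
  product diagram `X₁ ⟵ X ⟶ X₂`. -/
  isProductDiagram : ∀ {A₁ A₂ X₁ X₂ : C} (a₁ : A ⟶ A₁) (a₂ : A ⟶ A₂)
    (f₁ : A₁ ⟶ X₁) (f₂ : A₂ ⟶ X₂) (x₁ : X ⟶ X₁) (x₂ : X ⟶ X₂),
    IsProductDiagram a₁ a₂ → IsPushout a₁ f f₁ x₁ → IsPushout a₂ f f₂ x₂ →
    IsProductDiagram x₁ x₂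
  /-- In any commutative diagram with both rows product diagrams and with `f` as its middle column,
  the two squares are pushouts. -/
  isPushout : ∀ {A₁ A₂ X₁ X₂ : C} (a₁ : A ⟶ A₁) (a₂ : A ⟶ A₂)
    (f₁ : A₁ ⟶ X₁) (f₂ : A₂ ⟶ X₂) (x₁ : X ⟶ X₁) (x₂ : X ⟶ X₂),
    a₁ ≫ f₁ = f ≫ x₁ → a₂ ≫ f₂ = f ≫ x₂ →
    IsProductDiagram a₁ a₂ → IsProductDiagram x₁ x₂ →
    IsPushout a₁ f f₁ x₁ ∧ IsPushout a₂ f f₂ x₂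

end Coextensive

/-- A monoid is centerless if its center `{x | ∀ y, x * y = y * x}` contains only the neutral
element. -/
def IsCenterlessMonoid (M : Type u) [Monoid M] : Prop :=
  Submonoid.center M = ⊥

/-! Let `M` decompose as `A × B` and as `A₁ × A₂`. The image in `A` of the `A₁`-part of an element
of `B` is central in `A`, so its image in `M` is central, hence trivial (`fst_inl_fst_inr`). The
idempotent endomorphism of `M` that projects onto `A₁` therefore descends along `p` to `A`. This
makes the pushouts retracts of `A` (`exists_section`), and the two retracts decompose `A`, which is
(C1). For (C2) centerlessness plays no role: a cocone out of `A` kills the `X₂`-part. -/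

/-- Commuting sections of the two projections of a product diagram of monoids, together with the
joint injectivity of the projections. -/
structure ProductSections {M A B : Type u} [Monoid M] [Monoid A] [Monoid B]
    (p : M →* A) (q : M →* B) where
  /-- The section of the first projection. -/
  inl : A →* M
  /-- The section of the second projection. -/
  inr : B →* M
  fst_inl : ∀ a, p (inl a) = a
  snd_inl : ∀ a, q (inl a) = 1
  fst_inr : ∀ b, p (inr b) = 1
  snd_inr : ∀ b, q (inr b) = b
  ext : ∀ x y, p x = p y → q x = q y → x = y

namespace ProductSections

variable {M A B : Type u} [Monoid M] [Monoid A] [Monoid B] {p : M →* A} {q : M →* B}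

/-- Exchange of the two factors. -/
def symm (S : ProductSections p q) : ProductSections q p where
  inl := S.inr
  inr := S.inl
  fst_inl := S.snd_inr
  snd_inl := S.fst_inr
  fst_inr := S.snd_inl
  snd_inr := S.fst_inl
  ext x y h₁ h₂ := S.ext x y h₂ h₁

theorem inl_mul_inr (S : ProductSections p q) (m : M) : S.inl (p m) * S.inr (q m) = m := by
  apply S.ext <;> simp [S.fst_inl, S.snd_inl, S.fst_inr, S.snd_inr]

theorem commute (S : ProductSections p q) (a : A) (b : B) :
    Commute (S.inl a) (S.inr b) := by
  apply S.ext <;> simp [S.fst_inl, S.snd_inl, S.fst_inr, S.snd_inr]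

theorem commute_inl_of_commute (S : ProductSections p q) {a : A} (h : ∀ a', Commute a a') (m : M) :
    Commute (S.inl a) m := by
  rw [← S.inl_mul_inr m]
  exact ((h _).map S.inl).mul_right (S.commute _ _)

variable {A₁ A₂ : Type u} [Monoid A₁] [Monoid A₂] {a₁ : M →* A₁} {a₂ : M →* A₂}

/-- In a centerless monoid, the projections of any two product decompositions are compatible:
the projection onto a factor of the second decomposition preserves the factors of the first. -/
theorem fst_inl_fst_inr (S : ProductSections p q) (T : ProductSections a₁ a₂)
    (hM : Submonoid.center M = ⊥) (b : B) : p (T.inl (a₁ (S.inr b))) = 1 := by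
  -- Split `S.inl a'` along `T`: its `A₁`-part commutes with that of `S.inr b`, and its `A₂`-part
  -- commutes with everything from `A₁`.
  have hc : ∀ a', Commute (p (T.inl (a₁ (S.inr b)))) a' := by
    intro a'
    have h₁ : Commute (p (T.inl (a₁ (S.inr b)))) (p (T.inl (a₁ (S.inl a')))) :=
      ((((S.commute a' b).symm.map a₁).map T.inl).map p)
    have h₂ : Commute (p (T.inl (a₁ (S.inr b)))) (p (T.inr (a₂ (S.inl a')))) :=
      (T.commute _ _).map p
    have h := h₁.mul_right h₂
    rwa [← map_mul, T.inl_mul_inr, S.fst_inl] at h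
  have hz : S.inl (p (T.inl (a₁ (S.inr b)))) ∈ Submonoid.center M :=
    Submonoid.mem_center_iff.2 fun g => (S.commute_inl_of_commute hc g).symm
  rw [hM, Submonoid.mem_bot] at hz
  rw [← S.fst_inl (p _), hz, map_one]

/-- The `B`-part of `m` contributes nothing; this is the cocone condition in `exists_section`. -/
theorem fst_inl_fst (S : ProductSections p q) (T : ProductSections a₁ a₂)
    (hM : Submonoid.center M = ⊥) (m : M) :
    p (T.inl (a₁ (S.inl (p m)))) = p (T.inl (a₁ m)) := by
  conv_rhs => rw [← S.inl_mul_inr m]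
  simp [S.fst_inl_fst_inr T hM]

/-- The decomposition that a decomposition of `M` induces on its factor `A`. -/
theorem induced_mul (S : ProductSections p q) (T : ProductSections a₁ a₂) (a : A) :
    p (T.inl (a₁ (S.inl a))) * p (T.inr (a₂ (S.inl a))) = a := by
  rw [← map_mul, T.inl_mul_inr, S.fst_inl]

end ProductSections

namespace IsProductDiagram

theorem symm {C : Type u} [Category.{v} C] {X X₁ X₂ : C} {p₁ : X ⟶ X₁} {p₂ : X ⟶ X₂}
    (h : IsProductDiagram p₁ p₂) : IsProductDiagram p₂ p₁ :=
  h.map BinaryFan.isLimitFlip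

variable {M A B : MonCat.{u}} {p : M ⟶ A} {q : M ⟶ B}

/-- The sections pair an identity with a trivial homomorphism. -/
theorem nonempty_productSections (h : IsProductDiagram p q) :
    Nonempty (ProductSections p.hom q.hom) := by
  obtain ⟨h⟩ := h
  let s : A ⟶ M := h.lift (BinaryFan.mk (𝟙 A) (MonCat.ofHom 1))
  let t : B ⟶ M := h.lift (BinaryFan.mk (MonCat.ofHom 1) (𝟙 B))
  have hsp : s ≫ p = 𝟙 A := h.fac (BinaryFan.mk (𝟙 A) (MonCat.ofHom 1)) ⟨.left⟩
  have hsq : s ≫ q = MonCat.ofHom 1 := h.fac (BinaryFan.mk (𝟙 A) (MonCat.ofHom 1)) ⟨.right⟩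
  have htp : t ≫ p = MonCat.ofHom 1 := h.fac (BinaryFan.mk (MonCat.ofHom 1) (𝟙 B)) ⟨.left⟩
  have htq : t ≫ q = 𝟙 B := h.fac (BinaryFan.mk (MonCat.ofHom 1) (𝟙 B)) ⟨.right⟩
  refine ⟨⟨s.hom, t.hom, fun a => ConcreteCategory.congr_hom hsp a,
    fun a => ConcreteCategory.congr_hom hsq a, fun a => ConcreteCategory.congr_hom htp a,
    fun a => ConcreteCategory.congr_hom htq a, fun x y h₁ h₂ => ?_⟩⟩
  refine Concrete.isLimit_ext _ h x y ?_
  rintro ⟨_ | _⟩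
  · exact h₁
  · exact h₂

theorem of_productSections (S : ProductSections p.hom q.hom) : IsProductDiagram p q := by
  refine ⟨BinaryFan.IsLimit.mk _ (fun {T} f g => MonCat.ofHom
    { toFun := fun x => S.inl (f x) * S.inr (g x)
      map_one' := by simp
      map_mul' := fun x y => by
        simp only [map_mul]
        exact (S.commute _ _).symm.mul_mul_mul_comm _ _ |>.symm }) ?_ ?_ ?_⟩
  · intro T f g
    ext x
    change p.hom (S.inl (f x) * S.inr (g x)) = f x
    rw [map_mul, S.fst_inl, S.fst_inr, mul_one]
  · intro T f g
    ext x
    change q.hom (S.inl (f x) * S.inr (g x)) = g x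
    rw [map_mul, S.snd_inl, S.snd_inr, one_mul]
  · intro T f g m h₁ h₂
    ext x
    subst h₁ h₂
    exact (S.inl_mul_inr (m x)).symm

end IsProductDiagram

section Squares

variable {M A B A₁ A₂ X₁ X₂ : MonCat.{u}} {p : M ⟶ A} {q : M ⟶ B} {a₁ : M ⟶ A₁} {a₂ : M ⟶ A₂}
  {f₁ : A₁ ⟶ X₁} {f₂ : A₂ ⟶ X₂} {x₁ : A ⟶ X₁} {x₂ : A ⟶ X₂}

/-- Commutativity of the square suffices: `T.inl ∘ a₁` does not change the value of `a₁`. -/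
theorem ProductSections.comp_induced (S : ProductSections p.hom q.hom)
    (T : ProductSections a₁.hom a₂.hom) (w : a₁ ≫ f₁ = p ≫ x₁) (a : A) :
    x₁ (p.hom (T.inl (a₁.hom (S.inl a)))) = x₁ a := by
  have e : ∀ m, f₁ (a₁.hom m) = x₁ (p.hom m) := fun m => ConcreteCategory.congr_hom w m
  rw [← e, T.fst_inl, e, S.fst_inl]

theorem ProductSections.comp_inr (T : ProductSections a₁.hom a₂.hom) (w : a₁ ≫ f₁ = p ≫ x₁)
    (c : A₂) : x₁ (p.hom (T.inr c)) = 1 := by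
  have e : ∀ m, f₁ (a₁.hom m) = x₁ (p.hom m) := fun m => ConcreteCategory.congr_hom w m
  rw [← e, T.fst_inr, map_one]

/-- The pushout of a projection of a centerless monoid along another projection is a retract. -/
theorem ProductSections.exists_section (S : ProductSections p.hom q.hom)
    (T : ProductSections a₁.hom a₂.hom) (hM : IsCenterlessMonoid M)
    (h : IsPushout a₁ p f₁ x₁) :
    ∃ r : X₁ →* A, (∀ a, r (x₁ a) = p.hom (T.inl (a₁.hom (S.inl a)))) ∧ ∀ x, x₁ (r x) = x := by
  let k : A ⟶ A := MonCat.ofHom (p.hom.comp (T.inl.comp (a₁.hom.comp S.inl)))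
  let l : A₁ ⟶ A := MonCat.ofHom (p.hom.comp T.inl)
  have w : a₁ ≫ l = p ≫ k := by
    ext m
    exact (S.fst_inl_fst T hM m).symm
  have hr : ∀ a, h.desc l k w (x₁ a) = k a := ConcreteCategory.congr_hom (h.inr_desc l k w)
  have hl : ∀ c, h.desc l k w (f₁ c) = l c := ConcreteCategory.congr_hom (h.inl_desc l k w)
  have hx : h.desc l k w ≫ x₁ = 𝟙 X₁ := by
    apply h.hom_ext
    · ext c
      change x₁ (h.desc l k w (f₁ c)) = f₁ c
      rw [hl]
      change x₁ (p.hom (T.inl c)) = f₁ c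
      have e := ConcreteCategory.congr_hom h.w (T.inl c)
      change f₁ (a₁.hom (T.inl c)) = x₁ (p.hom (T.inl c)) at e
      rw [← e, T.fst_inl]
    · ext a
      change x₁ (h.desc l k w (x₁ a)) = x₁ a
      rw [hr]
      exact S.comp_induced T h.w a
  exact ⟨(h.desc l k w).hom, hr, fun x => ConcreteCategory.congr_hom hx x⟩

theorem ProductSections.isProductDiagram_of_isPushout (S : ProductSections p.hom q.hom)
    (T : ProductSections a₁.hom a₂.hom) (hM : IsCenterlessMonoid M)
    (h₁ : IsPushout a₁ p f₁ x₁) (h₂ : IsPushout a₂ p f₂ x₂) : IsProductDiagram x₁ x₂ := by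
  obtain ⟨r₁, hr₁, hx₁⟩ := S.exists_section T hM h₁
  obtain ⟨r₂, hr₂, hx₂⟩ := S.exists_section T.symm hM h₂
  -- The retractions from the pushouts serve as sections of `x₁` and `x₂`; joint injectivity holds
  -- because `a = r₁ (x₁ a) * r₂ (x₂ a)`.
  refine IsProductDiagram.of_productSections ⟨r₁, r₂, hx₁, fun x => ?_, fun x => ?_, hx₂, ?_⟩
  · rw [← hx₁ x, hr₁]
    exact T.symm.comp_inr h₂.w _
  · rw [← hx₂ x, hr₂]
    exact T.comp_inr h₁.w _
  · intro a b h h'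
    rw [← S.induced_mul T a, ← S.induced_mul T b, ← hr₁, ← hr₁]
    change _ * p.hom (T.symm.inl _) = _ * p.hom (T.symm.inl _)
    rw [← hr₂, ← hr₂]
    exact congrArg₂ (fun u v => r₁ u * r₂ v) h h'

theorem ProductSections.isPushout_of_isProductDiagram (S : ProductSections p.hom q.hom)
    (T : ProductSections a₁.hom a₂.hom) (U : ProductSections x₁.hom x₂.hom)
    (w₁ : a₁ ≫ f₁ = p ≫ x₁) (w₂ : a₂ ≫ f₂ = p ≫ x₂) : IsPushout a₁ p f₁ x₁ := by
  have key : ∀ {Z : MonCat.{u}} (l : A₁ ⟶ Z) (k : A ⟶ Z), a₁ ≫ l = p ≫ k →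
      ∀ a, k (U.inl (x₁ a)) = k a := by
    intro Z l k w a
    -- Both components along `U` vanish: `x₁` absorbs the induced map, and `x₂` kills whatever comes
    -- from `A₁`.
    have hy : p.hom (T.inl (a₁.hom (S.inl (U.inr (x₂ a))))) = 1 := by
      apply U.ext
      · exact (S.comp_induced T w₁ _).trans ((U.fst_inr _).trans (map_one _).symm)
      · exact (T.symm.comp_inr w₂ _).trans (map_one _).symm
    -- `k` also absorbs the induced map, being part of a commutative square.
    have hk : k (U.inr (x₂ a)) = 1 := by
      rw [← S.comp_induced T w, hy, map_one]
    conv_rhs => rw [← U.inl_mul_inr a]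
    rw [map_mul]
    exact (mul_one _).symm.trans (congrArg _ hk.symm)
  refine ⟨⟨w₁⟩, ⟨PushoutCocone.IsColimit.mk w₁
    (fun s => MonCat.ofHom U.inl ≫ s.inr) (fun s => ?_) (fun s => ?_) (fun s m _ h => ?_)⟩⟩
  · ext c
    have e := ConcreteCategory.congr_hom w₁ (T.inl c)
    have e' := ConcreteCategory.congr_hom s.condition (T.inl c)
    change f₁ (a₁.hom (T.inl c)) = x₁ (p.hom (T.inl c)) at e
    change s.inl (a₁.hom (T.inl c)) = s.inr (p.hom (T.inl c)) at e'
    rw [T.fst_inl] at e e'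
    change s.inr (U.inl (f₁ c)) = s.inl c
    rw [e, e']
    exact key _ _ s.condition _
  · ext a
    exact key _ _ s.condition a
  · ext x
    have e := ConcreteCategory.congr_hom h (U.inl x)
    change m (x₁.hom (U.inl x)) = s.inr (U.inl x) at e
    rw [U.fst_inl] at e
    exact e

end Squares

theorem mainTheorem12 (M : MonCat.{u}) (hM : IsCenterlessMonoid M)
    (A : MonCat.{u}) (p : M ⟶ A) (hp : IsProductProjection p) :
    IsCoextensive p := by
  obtain ⟨B, q, hpq⟩ := hp
  obtain ⟨S⟩ := hpq.nonempty_productSections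
  refine ⟨fun a₁ a₂ _ => ⟨inferInstance, inferInstance⟩, ?_, ?_⟩
  · intro A₁ A₂ X₁ X₂ a₁ a₂ f₁ f₂ x₁ x₂ ha h₁ h₂
    obtain ⟨T⟩ := ha.nonempty_productSections
    exact S.isProductDiagram_of_isPushout T hM h₁ h₂
  · intro A₁ A₂ X₁ X₂ a₁ a₂ f₁ f₂ x₁ x₂ w₁ w₂ ha hx
    obtain ⟨T⟩ := ha.nonempty_productSections
    obtain ⟨U⟩ := hx.nonempty_productSections
    exact ⟨S.isPushout_of_isProductDiagram T U w₁ w₂,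
      S.isPushout_of_isProductDiagram T.symm U.symm w₂ w₁⟩
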